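/- A composite Bézier curve $\mathcal B:[0,1]\to\mathbb R^3$ is given by knots $0=\tau_0<\tau_1<\dots<\tau_m=1$ ($m\ge 1$) and, for $0\le k<m$, control points $p^k_0,\dots,p^k_{n_k}\in\mathbb R^3$ with $p^k_{n_k}=p^{k+1}_0$ for $k+1<m$, by $$\mathcal B(t)=\sum_{j=0}^{n_k}\binom{n_k}{j}s^j(1-s)^{n_k-j}\,p^k_j,\qquad s=\frac{t-\tau_k}{\tau_{k+1}-\tau_k},\quad t\in[\tau_k,\tau_{k+1}].$$ Its control polygon is the piecewise linear curve that runs through $p^k_0,\dots,p^k_{n_k}$ for $k=0,\dots,m-1$ in order, where on $[\tau_k,\tau_{k+1}]$ the vertices $p^k_0,\dots,p^k_{n_k}$ are reached at equally spaced parameters. One subdivision replaces each Bézier segment by its two halves, with the control points produced by the de Casteljau algorithm with parameter $\tfrac12$ (and halves each knot interval); after $i$ subdivisions one obtains a composite Bézier representation of the same curve with $2^i m$ segments, whose control polygon is denoted $\mathcal P_i$. A curve on $[0,1]$, open or closed, is called simple if it has no self-intersection other than a possible coincidence of its two end points. Corollary. Let $\mathcal B$ be a simple, regular ($\mathcal B'(t)\neq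 0$ for all $t\in[0,1]$), $C^1$ composite Bézier curve in $\mathbb R^3$; if $\mathcal B$ is closed, i.e. $\mathcal B(0)=\mathcal B(1)$, suppose also that it is $C^1$ where it closes up, at least in the sense that $\mathcal B'(1)$ is a positive multiple of $\mathcal B'(0)$. Then there is an $N$ such that for every $i\ge N$ the control polygon $\mathcal P_i$ is simple and ambient isotopic to $\mathcal B$: there are homeomorphisms $H_t:\mathbb R^3\to\mathbb R^3$, $t\in[0,1]$, with $(t,x)\mapsto H_t(x)$ continuous, $H_0=\mathrm{id}$ and $H_1(\mathcal P_i([0,1]))=\mathcal B([0,1])$. In particular, if $\mathcal B$ is closed, $\mathcal P_i$ has the same knot type as $\mathcal B$. -/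

import Mathlib

open Set

noncomputable section

/-- Euclidean three-space. -/
abbrev E3 : Type := EuclideanSpace ℝ (Fin 3)

/-- The single-segment Bézier curve of degree `n` with control points `p 0, …, p n`
(the values `p j` with `j > n` are irrelevant). -/
def bezier (n : ℕ) (p : ℕ → E3) (s : ℝ) : E3 :=
  ∑ j ∈ Finset.range (n + 1), (bernsteinPolynomial ℝ n j).eval s • p j

/-- The uniform parametrization over `[0, 1]` of the polygonal path with vertices `p 0, …, p n`:
it takes the value `p j` at `j / n` and is affine in between. -/
def polyPath (n : ℕ) (p : ℕ → E3) (s : ℝ) : E3 :=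
  AffineMap.lineMap (p ⌊(n : ℝ) * s⌋₊) (p (⌊(n : ℝ) * s⌋₊ + 1)) (Int.fract ((n : ℝ) * s))

theorem polyPath_node {n : ℕ} (hn : n ≠ 0) (p : ℕ → E3) (j : ℕ) :
    polyPath n p ((j : ℝ) / n) = p j := by
  have h : (n : ℝ) * ((j : ℝ) / n) = j := by field_simp
  simp [polyPath, h]

theorem bezier_zero (n : ℕ) (p : ℕ → E3) : bezier n p 0 = p 0 := by
  rw [bezier, Finset.sum_eq_single 0]
  · rw [bernsteinPolynomial.eval_at_0, if_pos rfl, one_smul]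
  · intro j _ hj
    rw [bernsteinPolynomial.eval_at_0, if_neg hj, zero_smul]
  · simp

theorem bezier_one (n : ℕ) (p : ℕ → E3) : bezier n p 1 = p n := by
  rw [bezier, Finset.sum_eq_single n]
  · rw [bernsteinPolynomial.eval_at_1, if_pos rfl, one_smul]
  · intro j _ hj
    rw [bernsteinPolynomial.eval_at_1, if_neg hj, zero_smul]
  · simp

theorem polyPath_zero (n : ℕ) (p : ℕ → E3) : polyPath n p 0 = p 0 := by
  simp [polyPath]

theorem polyPath_one (n : ℕ) (p : ℕ → E3) : polyPath n p 1 = p n := by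
  simp [polyPath]

/-- The control data of a composite Bézier curve parametrized over `[0, 1]`: `m ≥ 1` Bézier
segments, the `k`-th one of degree `deg k`, with control points `ctrl k 0, …, ctrl k (deg k)`,
and run through while the parameter traverses `[knot k, knot (k + 1)]`; consecutive segments share
an end point. Values of `deg`, `ctrl`, `knot` outside these index ranges are irrelevant. -/
structure CompositeBezier where
  m : ℕ
  m_pos : 0 < m
  deg : ℕ → ℕ
  ctrl : ℕ → ℕ → E3
  knot : ℕ → ℝ
  knot_zero : knot 0 = 0
  knot_last : knot m = 1
  knot_lt : ∀ k < m, knot k < knot (k + 1)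
  joined : ∀ k, k + 1 < m → ctrl k (deg k) = ctrl (k + 1) 0

namespace CompositeBezier

/-- The index of the segment that the parameter `t ∈ [0, 1]` belongs to: the number of interior
knots that are `≤ t`. -/
def segIndex (C : CompositeBezier) (t : ℝ) : ℕ :=
  ((Finset.Ico 1 C.m).filter (fun k => C.knot k ≤ t)).card

/-- The position in `[0, 1]` of `t` relative to the `k`-th knot interval. -/
def localParam (C : CompositeBezier) (k : ℕ) (t : ℝ) : ℝ :=
  (t - C.knot k) / (C.knot (k + 1) - C.knot k)

/-- The composite Bézier curve, as a map on `[0, 1]`. -/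
def curve (C : CompositeBezier) (t : ℝ) : E3 :=
  bezier (C.deg (C.segIndex t)) (C.ctrl (C.segIndex t)) (C.localParam (C.segIndex t) t)

/-- The control polygon of the composite curve (the union of the control polygons of the
segments), as a piecewise linear map on `[0, 1]`. -/
def polygon (C : CompositeBezier) (t : ℝ) : E3 :=
  polyPath (C.deg (C.segIndex t)) (C.ctrl (C.segIndex t)) (C.localParam (C.segIndex t) t)

theorem knot_mono (C : CompositeBezier) {a b : ℕ} (hab : a ≤ b) (hb : b ≤ C.m) :
    C.knot a ≤ C.knot b := by
  induction b, hab using Nat.le_induction with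
  | base => exact le_rfl
  | succ b _ ih => exact (ih (by omega)).trans (C.knot_lt b (by omega)).le

theorem segIndex_eq (C : CompositeBezier) {k : ℕ} (hk : k < C.m) {t : ℝ}
    (h0 : C.knot k ≤ t) (h1 : t < C.knot (k + 1) ∨ k + 1 = C.m) : C.segIndex t = k := by
  have : (Finset.Ico 1 C.m).filter (fun j => C.knot j ≤ t) = Finset.Ico 1 (k + 1) := by
    ext j
    simp only [Finset.mem_filter, Finset.mem_Ico]
    constructor
    · rintro ⟨⟨hj1, hj2⟩, hj3⟩
      refine ⟨hj1, ?_⟩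
      by_contra hcon
      rcases h1 with h1 | h1
      · exact absurd (C.knot_mono (by omega : k + 1 ≤ j) hj2.le) (by linarith [h1, hj3])
      · omega
    · rintro ⟨hj1, hj2⟩
      exact ⟨⟨hj1, by omega⟩, (C.knot_mono (by omega : j ≤ k) hk.le).trans h0⟩
  rw [segIndex, this]
  simp

theorem localParam_left (C : CompositeBezier) (k : ℕ) : C.localParam k (C.knot k) = 0 := by
  simp [localParam]

theorem localParam_right (C : CompositeBezier) {k : ℕ} (hk : k < C.m) :
    C.localParam k (C.knot (k + 1)) = 1 :=
  div_self (sub_ne_zero.2 (C.knot_lt k hk).ne')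

/-- On each closed knot interval the composite curve is the corresponding Bézier segment. -/
theorem curve_eq (C : CompositeBezier) {k : ℕ} (hk : k < C.m) {t : ℝ}
    (ht : t ∈ Icc (C.knot k) (C.knot (k + 1))) :
    C.curve t = bezier (C.deg k) (C.ctrl k) (C.localParam k t) := by
  by_cases h : t < C.knot (k + 1) ∨ k + 1 = C.m
  · rw [curve, C.segIndex_eq hk ht.1 h]
  · push Not at h
    have hk' : k + 1 < C.m := by omega
    have htk : t = C.knot (k + 1) := le_antisymm ht.2 h.1
    rw [curve, C.segIndex_eq hk' h.1 (Or.inl (htk ▸ C.knot_lt _ hk')), htk, localParam_left,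
      C.localParam_right hk, bezier_zero, bezier_one, C.joined k hk']

/-- On each closed knot interval the control polygon is that of the corresponding segment. -/
theorem polygon_eq (C : CompositeBezier) {k : ℕ} (hk : k < C.m) {t : ℝ}
    (ht : t ∈ Icc (C.knot k) (C.knot (k + 1))) :
    C.polygon t = polyPath (C.deg k) (C.ctrl k) (C.localParam k t) := by
  by_cases h : t < C.knot (k + 1) ∨ k + 1 = C.m
  · rw [polygon, C.segIndex_eq hk ht.1 h]
  · push Not at h
    have hk' : k + 1 < C.m := by omega
    have htk : t = C.knot (k + 1) := le_antisymm ht.2 h.1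
    rw [polygon, C.segIndex_eq hk' h.1 (Or.inl (htk ▸ C.knot_lt _ hk')), htk, localParam_left,
      C.localParam_right hk, polyPath_zero, polyPath_one, C.joined k hk']

end CompositeBezier

/-- The triangular array of the de Casteljau algorithm with parameter `1 / 2`: row `0` consists of
the control points, row `r + 1` of the midpoints of the segments joining consecutive points of
row `r`. -/
def deCasteljau (p : ℕ → E3) : ℕ → ℕ → E3
  | 0, j => p j
  | r + 1, j => midpoint ℝ (deCasteljau p r j) (deCasteljau p r (j + 1))

/-- The control points of the left half of a Bézier curve: the left edge of the triangle. -/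
def leftHalf (p : ℕ → E3) (j : ℕ) : E3 := deCasteljau p j 0

/-- The control points of the right half of a Bézier curve of degree `n`: the right edge of the
triangle, traversed from the apex. -/
def rightHalf (n : ℕ) (p : ℕ → E3) (j : ℕ) : E3 := deCasteljau p (n - j) j

/-- One subdivision step: each segment is replaced by its left and its right half, and each knot
interval is cut at its midpoint. -/
def CompositeBezier.subdivide (C : CompositeBezier) : CompositeBezier where
  m := 2 * C.m
  m_pos := Nat.mul_pos two_pos C.m_pos
  deg k := C.deg (k / 2)
  ctrl k := if k % 2 = 0 then leftHalf (C.ctrl (k / 2))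
    else rightHalf (C.deg (k / 2)) (C.ctrl (k / 2))
  knot k := if k % 2 = 0 then C.knot (k / 2)
    else (C.knot (k / 2) + C.knot (k / 2 + 1)) / 2
  knot_zero := by simp [C.knot_zero]
  knot_last := by simp [C.knot_last]
  knot_lt k hk := by
    have h := C.knot_lt (k / 2) (by omega)
    rcases Nat.mod_two_eq_zero_or_one k with h2 | h2
    · have h3 : (k + 1) % 2 = 1 := by omega
      have h4 : (k + 1) / 2 = k / 2 := by omega
      simp only [h2, h3, h4, if_true, one_ne_zero, if_false]
      linarith
    · have h3 : (k + 1) % 2 = 0 := by omega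
      have h4 : (k + 1) / 2 = k / 2 + 1 := by omega
      simp only [h2, h3, h4, if_true, one_ne_zero, if_false]
      linarith
  joined k hk := by
    rcases Nat.mod_two_eq_zero_or_one k with h2 | h2
    · have h3 : (k + 1) % 2 = 1 := by omega
      have h4 : (k + 1) / 2 = k / 2 := by omega
      simp [h2, h3, h4, leftHalf, rightHalf]
    · have h3 : (k + 1) % 2 = 0 := by omega
      have h4 : (k + 1) / 2 = k / 2 + 1 := by omega
      simp only [h2, h3, h4, if_true, one_ne_zero, if_false, leftHalf, rightHalf, Nat.sub_self,
        deCasteljau]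
      exact C.joined (k / 2) (by omega)

/-- A curve on `[0, 1]` is simple if it has no self-intersections, except that its two end points
may coincide (a closed curve). -/
def IsSimpleCurve (γ : ℝ → E3) : Prop :=
  ∀ s ∈ Icc (0 : ℝ) 1, ∀ t ∈ Icc (0 : ℝ) 1, γ s = γ t →
    s = t ∨ (s = 0 ∧ t = 1) ∨ (s = 1 ∧ t = 0)

/-- A curve on `[0, 1]` is regular if its first derivative (one-sided at the end points) never
vanishes. -/
def IsRegularCurve (γ : ℝ → E3) : Prop :=
  ∀ t ∈ Icc (0 : ℝ) 1, derivWithin γ (Icc 0 1) t ≠ 0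

/-- A curve on `[0, 1]` is `C¹` if it is continuously differentiable on `[0, 1]` (one-sidedly at
the end points) and, in case it is closed, also has a continuous tangent direction at the point
where it closes up. -/
def IsC1Curve (γ : ℝ → E3) : Prop :=
  ContDiffOn ℝ 1 γ (Icc 0 1) ∧
    (γ 0 = γ 1 → SameRay ℝ (derivWithin γ (Icc 0 1) 0) (derivWithin γ (Icc 0 1) 1))

/-- Two subsets of `ℝ³` are ambient isotopic if a continuous family `H t`, `t ∈ [0, 1]`, of
homeomorphisms of `ℝ³` starts at the identity and ends at one that carries `X` onto `Y`. -/
def AmbientIsotopic (X Y : Set E3) : Prop :=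
  ∃ H : unitInterval → (E3 ≃ₜ E3),
    Continuous (fun q : unitInterval × E3 => H q.1 q.2) ∧
      H 0 = Homeomorph.refl E3 ∧ H 1 '' X = Y

end

/-! The polygon is a perturbation of the curve that is small in the Lipschitz sense, not only
uniformly. Each subdivision divides second differences of control points by 4 and knot intervals by
2. The difference of polygon and curve has Lipschitz constant at most `2 * d ^ 2 * M / h` in the
parameter, so after `i` subdivisions it is `O(2⁻ⁱ)` (`HasBounds.norm_polygon_sub_curve_le`).

By compactness, a simple regular `C¹` curve separates points at least proportionally to parameter
distance, cyclic if it is closed (`exists_pos_mul_le_norm_sub`). Hence the difference is a Lipschitz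
function of the point on the curve. Extended to `F` on all of space with constant below 1, it makes
every `x ↦ x + t • F x` with `t ∈ [0, 1]` a homeomorphism. The one at `t = 1` carries curve to
polygon, which gives simplicity and the isotopy together. -/

/-! ### Operator calculus for Bézier curves and their halves -/

/-- The shift operator on sequences of points. -/
noncomputable def seqShift : Module.End ℝ (ℕ → E3) := LinearMap.funLeft ℝ E3 Nat.succ

theorem seqShift_pow_apply (r : ℕ) (p : ℕ → E3) (j : ℕ) : (seqShift ^ r) p j = p (j + r) := by
  induction r generalizing p with
  | zero => rfl
  | succ r ih =>
    rw [pow_succ, Module.End.mul_apply, ih]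
    rfl

/-- The operator replacing a sequence of points by the midpoints of consecutive ones. -/
noncomputable def seqMid : Module.End ℝ (ℕ → E3) :=
  (1 / 2 : ℝ) • 1 + (1 / 2 : ℝ) • seqShift

theorem deCasteljau_eq (p : ℕ → E3) (r j : ℕ) : deCasteljau p r j = (seqMid ^ r) p j := by
  induction r generalizing j with
  | zero => rfl
  | succ r ih =>
    rw [deCasteljau, ih, ih, pow_succ', Module.End.mul_apply, midpoint_eq_smul_add, smul_add]
    simp [seqMid, seqShift, LinearMap.funLeft_apply]

theorem commute_seqShift_seqMid : Commute seqShift seqMid :=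
  ((Commute.one_right _).smul_right _).add_right ((Commute.refl _).smul_right _)

/-- The binomial theorem for commuting operators. The pairs (shift, 1), (midpoint, 1) and (shift,
midpoint) give the curve and its left and right halves. -/
theorem sum_bernstein_smul_pow {V : Type*} [AddCommGroup V] [Module ℝ V] {A B : Module.End ℝ V}
    (h : Commute A B) (n : ℕ) (s : ℝ) (p : V) :
    ∑ j ∈ Finset.range (n + 1), (bernsteinPolynomial ℝ n j).eval s • (A ^ j) ((B ^ (n - j)) p) =
      ((s • A + (1 - s) • B) ^ n) p := by
  rw [((h.smul_left s).smul_right (1 - s)).add_pow, LinearMap.sum_apply]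
  refine Finset.sum_congr rfl fun j _ => ?_
  rw [← Nat.cast_comm, ← nsmul_eq_mul, smul_pow, smul_pow, smul_mul_smul_comm,
    ← Nat.cast_smul_eq_nsmul ℝ, smul_smul]
  simp [bernsteinPolynomial, Module.End.mul_apply, mul_assoc]

theorem bezier_eq_pow (n : ℕ) (p : ℕ → E3) (s : ℝ) :
    bezier n p s = ((s • seqShift + (1 - s) • 1) ^ n) p 0 := by
  rw [← sum_bernstein_smul_pow (Commute.one_right _), Finset.sum_apply]
  simp [bezier, seqShift_pow_apply]

theorem bezier_leftHalf (n : ℕ) (p : ℕ → E3) (s : ℝ) :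
    bezier n (leftHalf p) s = bezier n p (s / 2) := by
  have h : (s / 2) • seqShift + (1 - s / 2) • 1 = s • seqMid + (1 - s) • 1 := by
    rw [seqMid]; module
  rw [bezier_eq_pow n p, h, ← sum_bernstein_smul_pow (Commute.one_right _), Finset.sum_apply]
  simp [bezier, leftHalf, deCasteljau_eq]

theorem bezier_rightHalf (n : ℕ) (p : ℕ → E3) (s : ℝ) :
    bezier n (rightHalf n p) s = bezier n p ((1 + s) / 2) := by
  have h : ((1 + s) / 2) • seqShift + (1 - (1 + s) / 2) • 1
      = s • seqShift + (1 - s) • seqMid := by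
    rw [seqMid]; module
  rw [bezier_eq_pow n p, h, ← sum_bernstein_smul_pow commute_seqShift_seqMid, Finset.sum_apply]
  simp [bezier, rightHalf, deCasteljau_eq, seqShift_pow_apply]

/-! ### Decay of second differences under subdivision -/

/-- The second differences of a sequence of points. -/
noncomputable def secondDiff (p : ℕ → E3) (j : ℕ) : E3 := p j - (2 : ℝ) • p (j + 1) + p (j + 2)

/-- Second differencing commutes with averaging neighbours, and averaging does not increase a norm
bound. -/
theorem norm_secondDiff_deCasteljau_le {p : ℕ → E3} {M : ℝ} {r j : ℕ}
    (h : ∀ l, j ≤ l → l ≤ j + r → ‖secondDiff p l‖ ≤ M) :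
    ‖secondDiff (deCasteljau p r) j‖ ≤ M := by
  induction r generalizing j with
  | zero => exact h j le_rfl le_rfl
  | succ r ih =>
    have h0 := ih (j := j) fun l h1 h2 => h l h1 (by omega)
    have h1 := ih (j := j + 1) fun l h1 h2 => h l (by omega) (by omega)
    have e : secondDiff (deCasteljau p (r + 1)) j = (1 / 2 : ℝ) •
        (secondDiff (deCasteljau p r) j + secondDiff (deCasteljau p r) (j + 1)) := by
      simp only [secondDiff, deCasteljau, midpoint_eq_smul_add, invOf_eq_inv]
      module
    rw [e, norm_smul]
    have := norm_add_le (secondDiff (deCasteljau p r) j) (secondDiff (deCasteljau p r) (j + 1))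
    norm_num
    linarith

/-- Three consecutive points on the edge of the triangle are combinations of three neighbours in a
single row; their second difference is exactly a quarter of that row's. -/
theorem norm_secondDiff_leftHalf_le {p : ℕ → E3} {M : ℝ} {n j : ℕ}
    (h : ∀ l, l + 2 ≤ n → ‖secondDiff p l‖ ≤ M) (hj : j + 2 ≤ n) :
    ‖secondDiff (leftHalf p) j‖ ≤ M / 4 := by
  have e : secondDiff (leftHalf p) j = (1 / 4 : ℝ) • secondDiff (deCasteljau p j) 0 := by
    simp only [secondDiff, leftHalf, deCasteljau, midpoint_eq_smul_add, invOf_eq_inv]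
    module
  have := norm_secondDiff_deCasteljau_le (p := p) (M := M) (r := j) (j := 0)
    fun l _ _ => h l (by omega)
  rw [e, norm_smul]
  norm_num
  linarith

theorem norm_secondDiff_rightHalf_le {p : ℕ → E3} {M : ℝ} {n j : ℕ}
    (h : ∀ l, l + 2 ≤ n → ‖secondDiff p l‖ ≤ M) (hj : j + 2 ≤ n) :
    ‖secondDiff (rightHalf n p) j‖ ≤ M / 4 := by
  obtain ⟨a, rfl⟩ := Nat.exists_eq_add_of_le hj
  have e : secondDiff (rightHalf (j + 2 + a) p) j
      = (1 / 4 : ℝ) • secondDiff (deCasteljau p a) j := by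
    have h0 : j + 2 + a - j = a + 2 := by omega
    have h1 : j + 2 + a - (j + 1) = a + 1 := by omega
    have h2 : j + 2 + a - (j + 2) = a := by omega
    simp only [secondDiff, rightHalf, h0, h1, h2, deCasteljau, midpoint_eq_smul_add, invOf_eq_inv]
    module
  have := norm_secondDiff_deCasteljau_le (p := p) (M := M) (r := a) (j := j)
    fun l _ _ => h l (by omega)
  rw [e, norm_smul]
  norm_num
  linarith

/-! ### Lipschitz distance between a Bézier segment and its polygon -/

/-- A map that is `K`-Lipschitz between any two consecutive knots is `K`-Lipschitz. -/
theorem norm_sub_le_of_piecewise {f : ℝ → E3} {a : ℕ → ℝ} {K : ℝ} {m : ℕ}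
    (h : ∀ k < m, ∀ s t, a k ≤ s → s ≤ t → t ≤ a (k + 1) → ‖f t - f s‖ ≤ K * (t - s))
    {s t : ℝ} (hs : a 0 ≤ s) (hst : s ≤ t) (ht : t ≤ a m) : ‖f t - f s‖ ≤ K * (t - s) := by
  induction m generalizing s t with
  | zero =>
    obtain rfl : s = t := by linarith
    simp
  | succ m ih =>
    have ih := @ih fun k hk => h k (by omega)
    have hm := h m (by omega)
    rcases le_total t (a m) with h1 | h1
    · exact ih hs hst h1
    rcases le_total s (a m) with h2 | h2
    · calc ‖f t - f s‖ = ‖(f t - f (a m)) + (f (a m) - f s)‖ := by rw [sub_add_sub_cancel]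
        _ ≤ K * (t - a m) + K * (a m - s) :=
          (norm_add_le _ _).trans (add_le_add (hm _ _ le_rfl h1 ht) (ih hs h2 le_rfl))
        _ = K * (t - s) := by ring
    · exact hm s t h2 hst ht

theorem norm_diff_sub_diff_le {p : ℕ → E3} {M : ℝ} {n : ℕ}
    (h : ∀ l, l + 2 ≤ n → ‖secondDiff p l‖ ≤ M) {j : ℕ} (hj : j < n) :
    ‖(p (j + 1) - p j) - (p 1 - p 0)‖ ≤ j * M := by
  induction j with
  | zero => simp
  | succ j ih =>
    have e : (p (j + 1 + 1) - p (j + 1)) - (p 1 - p 0)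
        = secondDiff p j + ((p (j + 1) - p j) - (p 1 - p 0)) := by
      simp only [secondDiff]; module
    rw [e]
    have := norm_add_le_of_le (h j (by omega)) (ih (by omega))
    push_cast
    linarith

theorem polyPath_eq {n : ℕ} (p : ℕ → E3) {j : ℕ} (hj : j < n) {s : ℝ}
    (h0 : (j : ℝ) / n ≤ s) (h1 : s ≤ ((j + 1 : ℕ) : ℝ) / n) :
    polyPath n p s = p j + (n * s - j) • (p (j + 1) - p j) := by
  have hn : (0 : ℝ) < n := by exact_mod_cast (by omega : 0 < n)
  -- At the right end the floor is already `j + 1`, so that node is treated separately.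
  rcases h1.eq_or_lt with rfl | h1
  · rw [polyPath_node (by omega), mul_div_cancel₀ _ hn.ne']
    push_cast
    simp
  · rw [div_le_iff₀ hn] at h0
    rw [lt_div_iff₀ hn] at h1
    push_cast at h1
    have hf : ⌊(n : ℝ) * s⌋₊ = j := by
      rw [Nat.floor_eq_iff (by linarith [Nat.cast_nonneg (α := ℝ) j])]
      constructor <;> linarith
    have hz : ⌊(n : ℝ) * s⌋ = (j : ℤ) := by
      rw [Int.floor_eq_iff]
      push_cast
      constructor <;> linarith
    rw [polyPath, hf, Int.fract, hz, AffineMap.lineMap_apply_module']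
    push_cast
    rw [add_comm]

theorem norm_polyPath_sub_le {n : ℕ} {p : ℕ → E3} {v : E3} {L : ℝ}
    (h : ∀ j < n, ‖(p (j + 1) - p j) - v‖ ≤ L) {s t : ℝ} (hs : 0 ≤ s) (hst : s ≤ t)
    (ht : t ≤ 1) :
    ‖(polyPath n p t - (n * t) • v) - (polyPath n p s - (n * s) • v)‖ ≤ n * L * (t - s) := by
  rcases Nat.eq_zero_or_pos n with rfl | hn
  · simp [polyPath]
  have hn' : (0 : ℝ) < n := by exact_mod_cast hn
  refine norm_sub_le_of_piecewise (f := fun t => polyPath n p t - (n * t) • v)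
    (a := fun j => (j : ℝ) / n) (m := n) ?_ (by simpa using hs) hst
    (by simpa [div_self hn'.ne'] using ht)
  intro j hj s t hs hst ht
  have e : (polyPath n p t - (n * t) • v) - (polyPath n p s - (n * s) • v)
      = (n * (t - s)) • ((p (j + 1) - p j) - v) := by
    rw [polyPath_eq p hj hs (hst.trans ht), polyPath_eq p hj (hs.trans hst) ht]
    module
  have h3 : 0 ≤ n * (t - s) := mul_nonneg hn'.le (sub_nonneg.2 hst)
  rw [e, norm_smul, Real.norm_of_nonneg h3]
  calc _ ≤ n * (t - s) * L := mul_le_mul_of_nonneg_left (h j hj) h3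
    _ = _ := by ring

theorem hasDerivAt_bezier_succ (n : ℕ) (p : ℕ → E3) (s : ℝ) :
    HasDerivAt (bezier (n + 1) p) (((n : ℝ) + 1) •
      ∑ j ∈ Finset.range (n + 1), (bernsteinPolynomial ℝ n j).eval s • (p (j + 1) - p j)) s := by
  have h : HasDerivAt (bezier (n + 1) p) (∑ j ∈ Finset.range (n + 1 + 1),
      (Polynomial.derivative (bernsteinPolynomial ℝ (n + 1) j)).eval s • p j) s :=
    HasDerivAt.fun_sum fun j _ => ((bernsteinPolynomial ℝ (n + 1) j).hasDerivAt s).smul_const (p j)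
  refine h.congr_deriv ?_
  have h1 : ∑ j ∈ Finset.range (n + 1), (bernsteinPolynomial ℝ n j).eval s • p j
      = ∑ j ∈ Finset.range (n + 1), (bernsteinPolynomial ℝ n (j + 1)).eval s • p (j + 1)
        + (bernsteinPolynomial ℝ n 0).eval s • p 0 := by
    rw [← Finset.sum_range_succ' fun j => (bernsteinPolynomial ℝ n j).eval s • p j,
      Finset.sum_range_succ _ (n + 1), bernsteinPolynomial.eq_zero_of_lt ℝ (Nat.lt_succ_self n)]
    simp
  have h2 : ∀ j, (Polynomial.derivative (bernsteinPolynomial ℝ (n + 1) (j + 1))).eval s • p (j + 1)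
      = ((n : ℝ) + 1) • ((bernsteinPolynomial ℝ n j).eval s • p (j + 1)
        - (bernsteinPolynomial ℝ n (j + 1)).eval s • p (j + 1)) := by
    intro j
    simp [bernsteinPolynomial.derivative_succ, mul_smul, sub_smul]
  have h3 : (Polynomial.derivative (bernsteinPolynomial ℝ (n + 1) 0)).eval s • p 0
      = ((n : ℝ) + 1) • -((bernsteinPolynomial ℝ n 0).eval s • p 0) := by
    rw [bernsteinPolynomial.derivative_zero, ← neg_smul, smul_smul]
    congr 1
    simp
    ring
  simp only [Finset.sum_range_succ' _ (n + 1), h2, h3, ← Finset.smul_sum, smul_sub,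
    Finset.sum_sub_distrib, h1]
  module

theorem bernsteinPolynomial_eval_nonneg (n j : ℕ) {s : ℝ} (hs : s ∈ Icc (0 : ℝ) 1) :
    0 ≤ (bernsteinPolynomial ℝ n j).eval s := by
  have := sub_nonneg.2 hs.2
  have := hs.1
  simp only [bernsteinPolynomial, Polynomial.eval_mul, Polynomial.eval_natCast,
    Polynomial.eval_pow, Polynomial.eval_X, Polynomial.eval_sub, Polynomial.eval_one]
  positivity

theorem sum_bernsteinPolynomial_eval (n : ℕ) (s : ℝ) :
    ∑ j ∈ Finset.range (n + 1), (bernsteinPolynomial ℝ n j).eval s = 1 := by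
  rw [← Polynomial.eval_finsetSum, bernsteinPolynomial.sum, Polynomial.eval_one]

/-- The velocity is `n` times a convex combination of the polygon's edges, so it deviates from `n •
v` no more than the edges allow. -/
theorem norm_bezier_sub_le {n : ℕ} {p : ℕ → E3} {v : E3} {L : ℝ}
    (h : ∀ j < n, ‖(p (j + 1) - p j) - v‖ ≤ L) {s t : ℝ} (hs : 0 ≤ s) (hst : s ≤ t)
    (ht : t ≤ 1) :
    ‖(bezier n p t - (n * t) • v) - (bezier n p s - (n * s) • v)‖ ≤ n * L * (t - s) := by
  cases n with
  | zero => simp [bezier, bernsteinPolynomial]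
  | succ n =>
    have hd : ∀ x ∈ Icc (0 : ℝ) 1, HasDerivWithinAt
        (fun t => bezier (n + 1) p t - (((n + 1 : ℕ) : ℝ) * t) • v)
        (((n : ℝ) + 1) • ∑ j ∈ Finset.range (n + 1),
          (bernsteinPolynomial ℝ n j).eval x • ((p (j + 1) - p j) - v)) (Icc 0 1) x := by
      intro x _
      refine HasDerivAt.hasDerivWithinAt ?_
      refine ((hasDerivAt_bezier_succ n p x).sub
        (((hasDerivAt_id x).const_mul ((n + 1 : ℕ) : ℝ)).smul_const v)).congr_deriv ?_
      simp only [smul_sub _ _ v, Finset.sum_sub_distrib, ← Finset.sum_smul,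
        sum_bernsteinPolynomial_eval, mul_one, Nat.cast_add, Nat.cast_one, one_smul]
    have hb : ∀ x ∈ Icc (0 : ℝ) 1, ‖((n : ℝ) + 1) • ∑ j ∈ Finset.range (n + 1),
          (bernsteinPolynomial ℝ n j).eval x • ((p (j + 1) - p j) - v)‖
          ≤ ((n + 1 : ℕ) : ℝ) * L := by
      intro x hx
      rw [norm_smul, Real.norm_of_nonneg (by positivity)]
      push_cast
      refine mul_le_mul_of_nonneg_left ?_ (by positivity)
      calc _ ≤ ∑ j ∈ Finset.range (n + 1), (bernsteinPolynomial ℝ n j).eval x * L := by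
            refine norm_sum_le_of_le _ fun j hj => ?_
            rw [norm_smul, Real.norm_of_nonneg (bernsteinPolynomial_eval_nonneg n j hx)]
            exact mul_le_mul_of_nonneg_left (h j (Finset.mem_range.1 hj))
              (bernsteinPolynomial_eval_nonneg n j hx)
        _ = L := by rw [← Finset.sum_mul, sum_bernsteinPolynomial_eval, one_mul]
    have := (convex_Icc (0 : ℝ) 1).norm_image_sub_le_of_norm_hasDerivWithin_le hd hb
      ⟨hs, hst.trans ht⟩ ⟨hs.trans hst, ht⟩
    rwa [Real.norm_of_nonneg (sub_nonneg.2 hst)] at this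

/-- Both paths are compared with the uniform motion of velocity `n • (p 1 - p 0)`. Every edge is
within `n * M` of the first one, so each comparison costs `n ^ 2 * M`. -/
theorem norm_polyPath_sub_bezier_le {n : ℕ} {p : ℕ → E3} {M : ℝ} (hM : 0 ≤ M)
    (h : ∀ l, l + 2 ≤ n → ‖secondDiff p l‖ ≤ M) {s t : ℝ} (hs : 0 ≤ s) (hst : s ≤ t)
    (ht : t ≤ 1) :
    ‖(polyPath n p t - bezier n p t) - (polyPath n p s - bezier n p s)‖
      ≤ 2 * (n : ℝ) ^ 2 * M * (t - s) := by
  have hv : ∀ j < n, ‖(p (j + 1) - p j) - (p 1 - p 0)‖ ≤ n * M := fun j hj =>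
    (norm_diff_sub_diff_le h hj).trans
      (mul_le_mul_of_nonneg_right (by exact_mod_cast hj.le) hM)
  have e : (polyPath n p t - bezier n p t) - (polyPath n p s - bezier n p s)
      = ((polyPath n p t - (n * t) • (p 1 - p 0)) - (polyPath n p s - (n * s) • (p 1 - p 0)))
        - ((bezier n p t - (n * t) • (p 1 - p 0)) - (bezier n p s - (n * s) • (p 1 - p 0))) := by
    module
  rw [e]
  have := norm_sub_le_of_le (norm_polyPath_sub_le hv hs hst ht) (norm_bezier_sub_le hv hs hst ht)
  linarith

/-! ### Separation of points on a simple regular curve -/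

/-- A curve that is continuously differentiable on `[0, 1]` is, near `u`, arbitrarily close in the
Lipschitz sense to its linearization at `u`. -/
theorem ContDiffOn.exists_norm_sub_le {γ : ℝ → E3} (hγ : ContDiffOn ℝ 1 γ (Icc 0 1)) {u : ℝ}
    (hu : u ∈ Icc (0 : ℝ) 1) {ε : ℝ} (hε : 0 < ε) :
    ∃ r > 0, ∀ s ∈ Icc (0 : ℝ) 1, ∀ t ∈ Icc (0 : ℝ) 1, |s - u| < r → |t - u| < r → s ≤ t →
      ‖(γ t - γ s) - (t - s) • derivWithin γ (Icc 0 1) u‖ ≤ ε * (t - s) := by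
  have hd := hγ.continuousOn_derivWithin (uniqueDiffOn_Icc one_pos) le_rfl
  obtain ⟨r, hr, H⟩ := Metric.continuousOn_iff.1 hd u hu ε hε
  refine ⟨r, hr, fun s hs t ht hsr htr hst => ?_⟩
  have hderiv : ∀ x ∈ Icc (0 : ℝ) 1 ∩ Metric.ball u r, HasDerivWithinAt
      (fun x => γ x - x • derivWithin γ (Icc 0 1) u)
      (derivWithin γ (Icc 0 1) x - derivWithin γ (Icc 0 1) u) (Icc (0 : ℝ) 1 ∩ Metric.ball u r) x := by
    intro x hx
    have h1 := (((hγ.differentiableOn one_ne_zero) x hx.1).hasDerivWithinAt.mono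
      inter_subset_left).sub
      ((hasDerivWithinAt_id x (Icc (0 : ℝ) 1 ∩ Metric.ball u r)).smul_const
        (derivWithin γ (Icc 0 1) u))
    exact h1.congr_deriv (by rw [one_smul])
  have := ((convex_Icc (0 : ℝ) 1).inter (convex_ball u r)).norm_image_sub_le_of_norm_hasDerivWithin_le
    hderiv
    (fun x hx => (dist_eq_norm (derivWithin γ (Icc 0 1) x) _).symm.trans_le (H x hx.1 hx.2).le)
    ⟨hs, hsr⟩ ⟨ht, htr⟩
  rw [Real.norm_of_nonneg (sub_nonneg.2 hst)] at this
  have e : (γ t - γ s) - (t - s) • derivWithin γ (Icc 0 1) u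
      = (γ t - t • derivWithin γ (Icc 0 1) u) - (γ s - s • derivWithin γ (Icc 0 1) u) := by
    module
  rwa [e]

/-- A simple regular `C¹` curve is bi-Lipschitz from below: points of the curve are separated by at
least a fixed multiple of their parameter distance, which for a closed curve may be measured
across the point where the curve closes up. -/
theorem exists_pos_mul_le_norm_sub {γ : ℝ → E3} (hs : IsSimpleCurve γ) (hr : IsRegularCurve γ)
    (hc : IsC1Curve γ) :
    ∃ c > 0, ∀ s ∈ Icc (0 : ℝ) 1, ∀ t ∈ Icc (0 : ℝ) 1, s ≤ t →
      c * (t - s) ≤ ‖γ t - γ s‖ ∨ (γ 0 = γ 1 ∧ c * (s + (1 - t)) ≤ ‖γ t - γ s‖) := by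
  set I := Icc (0 : ℝ) 1
  have hcont : ContinuousOn γ I := hc.1.continuousOn
  suffices h : ∃ c > 0, ∀ q ∈ I ×ˢ I, q.1 ≤ q.2 →
      c * (q.2 - q.1) ≤ ‖γ q.2 - γ q.1‖ ∨
        (γ 0 = γ 1 ∧ c * (q.1 + (1 - q.2)) ≤ ‖γ q.2 - γ q.1‖) by
    obtain ⟨c, hc0, h⟩ := h
    exact ⟨c, hc0, fun s hs t ht hst => h (s, t) ⟨hs, ht⟩ hst⟩
  have hmono : ∀ {c c' : ℝ}, c ≤ c' → ∀ {q : ℝ × ℝ}, q ∈ I ×ˢ I → q.1 ≤ q.2 →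
      (c' * (q.2 - q.1) ≤ ‖γ q.2 - γ q.1‖ ∨
        (γ 0 = γ 1 ∧ c' * (q.1 + (1 - q.2)) ≤ ‖γ q.2 - γ q.1‖)) →
      (c * (q.2 - q.1) ≤ ‖γ q.2 - γ q.1‖ ∨
        (γ 0 = γ 1 ∧ c * (q.1 + (1 - q.2)) ≤ ‖γ q.2 - γ q.1‖)) := by
    intro c c' hcc q hq hle h
    refine h.imp (fun h => (mul_le_mul_of_nonneg_right hcc (sub_nonneg.2 hle)).trans h)
      (fun h => ⟨h.1, (mul_le_mul_of_nonneg_right hcc ?_).trans h.2⟩)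
    have h1 := hq.1.1
    have h2 := hq.2.2
    linarith
  -- The repeated membership is deliberate: compactness induction generalizes the first set to an
  -- arbitrary `S`, which need not lie in the square.
  suffices key : ∃ c > 0, ∀ q ∈ I ×ˢ I, q ∈ I ×ˢ I → q.1 ≤ q.2 →
      c * (q.2 - q.1) ≤ ‖γ q.2 - γ q.1‖ ∨
        (γ 0 = γ 1 ∧ c * (q.1 + (1 - q.2)) ≤ ‖γ q.2 - γ q.1‖) by
    obtain ⟨c, hc0, h⟩ := key
    exact ⟨c, hc0, fun q hq => h q hq hq⟩
  refine (isCompact_Icc.prod isCompact_Icc : IsCompact (I ×ˢ I)).induction_on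
    (p := fun S => ∃ c > 0, ∀ q ∈ S, q ∈ I ×ˢ I → q.1 ≤ q.2 →
      c * (q.2 - q.1) ≤ ‖γ q.2 - γ q.1‖ ∨
        (γ 0 = γ 1 ∧ c * (q.1 + (1 - q.2)) ≤ ‖γ q.2 - γ q.1‖))
    ⟨1, one_pos, fun q hq => hq.elim⟩ ?_ ?_ ?_
  · rintro S T hST ⟨c, hc0, h⟩
    exact ⟨c, hc0, fun q hq => h q (hST hq)⟩
  · rintro S T ⟨c, hc0, h⟩ ⟨c', hc0', h'⟩
    refine ⟨min c c', lt_min hc0 hc0', fun q hq hqI hle => ?_⟩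
    rcases hq with hq | hq
    · exact hmono (min_le_left _ _) hqI hle (h q hq hqI hle)
    · exact hmono (min_le_right _ _) hqI hle (h' q hq hqI hle)
  rintro ⟨u, v⟩ ⟨hu, hv⟩
  have hnear : ∀ {a r : ℝ}, 0 < r → ∀ᶠ x in nhds a, |x - a| < r := fun hr =>
    Metric.ball_mem_nhds _ hr
  rcases lt_or_ge v u with hvu | huv
  · refine ⟨{q | q.2 < q.1}, mem_nhdsWithin_of_mem_nhds
      ((isOpen_lt continuous_snd continuous_fst).mem_nhds hvu), 1, one_pos, ?_⟩
    intro q hq _ hle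
    exact absurd hle (not_le.2 hq)
  by_cases heq : γ u = γ v
  swap
  -- Away from coincidences continuity suffices, since parameter distances are at most 1.
  · have hpos : 0 < ‖γ v - γ u‖ := norm_pos_iff.2 (sub_ne_zero.2 (Ne.symm heq))
    have hco : ContinuousOn (fun q : ℝ × ℝ => ‖γ q.2 - γ q.1‖) (I ×ˢ I) :=
      ((hcont.comp continuousOn_snd fun q hq => hq.2).sub
        (hcont.comp continuousOn_fst fun q hq => hq.1)).norm
    refine ⟨{q | ‖γ v - γ u‖ / 2 < ‖γ q.2 - γ q.1‖},
      (hco (u, v) ⟨hu, hv⟩).eventually (lt_mem_nhds (half_lt_self hpos)),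
      ‖γ v - γ u‖ / 2, half_pos hpos, ?_⟩
    intro q hq hqI hle
    refine Or.inl (le_trans ?_ (le_of_lt hq))
    have h1 := hqI.1.1
    have h2 := hqI.2.2
    nlinarith
  rcases hs u hu v hv heq with rfl | ⟨rfl, rfl⟩ | ⟨rfl, rfl⟩
  · have hpos := norm_pos_iff.2 (hr u hu)
    obtain ⟨r, hr0, H⟩ := hc.1.exists_norm_sub_le hu (half_pos hpos)
    refine ⟨{q | |q.1 - u| < r ∧ |q.2 - u| < r}, mem_nhdsWithin_of_mem_nhds
      (prod_mem_nhds (hnear hr0) (hnear hr0)), _, half_pos hpos, ?_⟩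
    rintro ⟨s, t⟩ ⟨h1, h2⟩ hq hle
    have h3 := H s hq.1 t hq.2 h1 h2 hle
    have h4 := norm_sub_norm_le ((t - s) • derivWithin γ (Icc 0 1) u) (γ t - γ s)
    rw [norm_smul, Real.norm_of_nonneg (sub_nonneg.2 hle), norm_sub_rev _ (γ t - γ s)] at h4
    left
    dsimp only at h3 h4 ⊢
    linarith
  -- The closing point: `γ s - γ 0` and `γ 1 - γ t` are nearly `s • a` and `(1 - t) • b`. As `a` and
  -- `b` lie on one ray, the norms add without cancellation.
  · have hray := hc.2 heq
    set a := derivWithin γ (Icc 0 1) 0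
    set b := derivWithin γ (Icc 0 1) 1
    have hpos : 0 < min ‖a‖ ‖b‖ := lt_min (norm_pos_iff.2 (hr 0 hu)) (norm_pos_iff.2 (hr 1 hv))
    obtain ⟨r, hr0, H⟩ := hc.1.exists_norm_sub_le hu (half_pos hpos)
    obtain ⟨r', hr0', H'⟩ := hc.1.exists_norm_sub_le hv (half_pos hpos)
    refine ⟨{q | |q.1 - 0| < r ∧ |q.2 - 1| < r'}, mem_nhdsWithin_of_mem_nhds
      (prod_mem_nhds (hnear hr0) (hnear hr0')), _, half_pos hpos, ?_⟩
    rintro ⟨s, t⟩ ⟨h1, h2⟩ hq hle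
    have hs0 : 0 ≤ s - 0 := sub_nonneg.2 hq.1.1
    have ht1 : 0 ≤ 1 - t := sub_nonneg.2 hq.2.2
    have h3 := H 0 hu s hq.1 (by simpa using hr0) h1 hq.1.1
    have h4 := H' t hq.2 1 hv h2 (by simpa using hr0') hq.2.2
    have h5 : ‖(s - 0) • a + (1 - t) • b‖ = (s - 0) * ‖a‖ + (1 - t) * ‖b‖ := by
      rw [((hray.nonneg_smul_left hs0).nonneg_smul_right ht1).norm_add, norm_smul, norm_smul,
        Real.norm_of_nonneg hs0, Real.norm_of_nonneg ht1]
    have h6 : ‖(s - 0) • a + (1 - t) • b‖ ≤ ‖γ t - γ s‖ +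
        (min ‖a‖ ‖b‖ / 2 * (s - 0) + min ‖a‖ ‖b‖ / 2 * (1 - t)) := by
      have e : (s - 0) • a + (1 - t) • b = -(γ t - γ s) -
          (((γ s - γ 0) - (s - 0) • a) + ((γ 1 - γ t) - (1 - t) • b)) := by
        rw [heq]; module
      rw [e]
      refine norm_sub_le_of_le (norm_neg _).le (norm_add_le_of_le h3 h4)
    have h7 := mul_le_mul_of_nonneg_left (min_le_left ‖a‖ ‖b‖) hs0
    have h8 := mul_le_mul_of_nonneg_left (min_le_right ‖a‖ ‖b‖) ht1
    right
    refine ⟨heq, ?_⟩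
    dsimp only
    linarith
  · linarith

/-! ### Small Lipschitz perturbations and ambient isotopy -/

theorem exists_homeomorph_add {F : E3 → E3} {K : NNReal} (hF : LipschitzWith K F) (hK : K < 1) :
    ∃ h : E3 ≃ₜ E3, ∀ x, h x = x + F x := by
  have ha : ApproximatesLinearOn (fun x => x + F x)
      ((ContinuousLinearEquiv.refl ℝ E3 : E3 ≃L[ℝ] E3) : E3 →L[ℝ] E3) univ K := by
    refine LipschitzOnWith.approximatesLinearOn (LipschitzWith.lipschitzOnWith ?_)
    have e : (fun x => x + F x) - (((ContinuousLinearEquiv.refl ℝ E3 : E3 ≃L[ℝ] E3) :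
        E3 →L[ℝ] E3) : E3 → E3) = F := funext fun x => add_sub_cancel_left x (F x)
    rwa [e]
  refine ⟨ha.toHomeomorph _ (Or.inr ?_), fun x => rfl⟩
  have : ‖(((ContinuousLinearEquiv.refl ℝ E3).symm : E3 ≃L[ℝ] E3) : E3 →L[ℝ] E3)‖₊ = 1 := by
    ext
    exact ContinuousLinearMap.norm_id
  rw [this, inv_one]
  exact hK

/-- A small Lipschitz perturbation of the identity is isotopic to the identity. -/
theorem ambientIsotopic_image_add {F : E3 → E3} {K : NNReal} (hF : LipschitzWith K F) (hK : K < 1)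
    (X : Set E3) : AmbientIsotopic ((fun x => x + F x) '' X) X := by
  have hl : ∀ t : unitInterval, LipschitzWith K (fun x => (t : ℝ) • F x) := by
    intro t
    refine LipschitzWith.of_dist_le_mul fun x y => ?_
    rw [dist_smul₀, Real.norm_of_nonneg t.2.1]
    exact (mul_le_of_le_one_left dist_nonneg t.2.2).trans (hF.dist_le_mul x y)
  choose h hh using fun t => exists_homeomorph_add (hl t) hK
  -- With `h t = id + t • F`, the isotopy is `h (1 - t) ∘ (h 1)⁻¹`. Only one fixed inverse occurs,
  -- so joint continuity is immediate.
  refine ⟨fun t => (h 1).symm.trans (h (unitInterval.symm t)), ?_, ?_, ?_⟩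
  · have hc := hF.continuous
    simp only [Homeomorph.trans_apply, hh]
    fun_prop
  · ext1 x
    simp
  · have h0 : ∀ x, h 0 x = x := fun x => by simp [hh]
    rw [image_image]
    refine (image_congr fun x _ => ?_).trans (image_id X)
    have h1 : x + F x = h 1 x := by simp [hh]
    simp [h1, h0]

/-- A curve that differs from a simple regular `C¹` curve by a map with small Lipschitz constant,
and has the same end points, is simple and ambient isotopic to it. -/
theorem exists_isSimpleCurve_and_ambientIsotopic {γ : ℝ → E3} (hs : IsSimpleCurve γ)
    (hr : IsRegularCurve γ) (hc : IsC1Curve γ) :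
    ∃ ε > 0, ∀ η : ℝ → E3, η 0 = γ 0 → η 1 = γ 1 →
      (∀ s t, 0 ≤ s → s ≤ t → t ≤ 1 → ‖(η t - γ t) - (η s - γ s)‖ ≤ ε * (t - s)) →
      IsSimpleCurve η ∧ AmbientIsotopic (η '' Icc 0 1) (γ '' Icc 0 1) := by
  obtain ⟨c, hc0, H⟩ := exists_pos_mul_le_norm_sub hs hr hc
  set A := lipschitzExtensionConstant E3
  have hA : 0 < A := lipschitzExtensionConstant_pos E3
  -- Dividing by `c` passes from parameters to points, and extension to all of space costs a factor
  -- `A`; the final constant is `1 / 2`.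
  refine ⟨c / (2 * A), by positivity, fun η h0 h1 hη => ?_⟩
  have hLe : ∀ s ∈ Icc (0 : ℝ) 1, ∀ t ∈ Icc (0 : ℝ) 1, s ≤ t →
      ‖(η t - γ t) - (η s - γ s)‖ ≤ 1 / (2 * A) * ‖γ t - γ s‖ := by
    intro s hs t ht hst
    rcases H s hs t ht hst with h | ⟨-, h⟩
    · calc _ ≤ c / (2 * A) * (t - s) := hη s t hs.1 hst ht.2
        _ = 1 / (2 * A) * (c * (t - s)) := by ring
        _ ≤ _ := mul_le_mul_of_nonneg_left h (by positivity)
    -- Here the short way runs through the closing point; the difference vanishes at both ends, so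
    -- the two pieces combine.
    · have e : (η t - γ t) - (η s - γ s)
          = -((η 1 - γ 1) - (η t - γ t)) - ((η s - γ s) - (η 0 - γ 0)) := by
        rw [h0, h1]; module
      calc _ ≤ c / (2 * A) * (1 - t) + c / (2 * A) * (s - 0) := by
            rw [e]
            refine norm_sub_le_of_le ?_ (hη 0 s le_rfl hs.1 hs.2)
            rw [norm_neg]
            exact hη t 1 ht.1 ht.2 le_rfl
        _ = 1 / (2 * A) * (c * (s + (1 - t))) := by ring
        _ ≤ _ := mul_le_mul_of_nonneg_left h (by positivity)
  have hL : ∀ s ∈ Icc (0 : ℝ) 1, ∀ t ∈ Icc (0 : ℝ) 1,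
      ‖(η t - γ t) - (η s - γ s)‖ ≤ 1 / (2 * A) * ‖γ t - γ s‖ := by
    intro s hs t ht
    rcases le_total s t with hst | hst
    · exact hLe s hs t ht hst
    · rw [norm_sub_rev, norm_sub_rev (γ t)]
      exact hLe t ht s hs hst
  set f : E3 → E3 := fun x =>
    η (Function.invFunOn γ (Icc 0 1) x) - γ (Function.invFunOn γ (Icc 0 1) x)
  -- The choice of parameter is harmless: by `hL`, equal points of `γ` have equal differences, also
  -- where the curve closes.
  have hf : ∀ t ∈ Icc (0 : ℝ) 1, f (γ t) = η t - γ t := by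
    intro t ht
    have hm : γ t ∈ γ '' Icc 0 1 := mem_image_of_mem γ ht
    have := hL _ (Function.invFunOn_mem hm) t ht
    rw [Function.invFunOn_eq hm, sub_self, norm_zero, mul_zero, norm_le_zero_iff, sub_eq_zero] at this
    rw [this]
    simp only [f, Function.invFunOn_eq hm]
  have hflip : LipschitzOnWith (1 / (2 * A)) f (γ '' Icc 0 1) := by
    refine LipschitzOnWith.of_dist_le_mul ?_
    rintro _ ⟨t, ht, rfl⟩ _ ⟨s, hs, rfl⟩
    rw [hf t ht, hf s hs, dist_eq_norm, dist_eq_norm]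
    exact_mod_cast hL s hs t ht
  obtain ⟨F, hF, hEq⟩ := hflip.extend_finite_dimension
  have hK : lipschitzExtensionConstant E3 * (1 / (2 * A)) < 1 := by
    have : lipschitzExtensionConstant E3 * (1 / (2 * A)) = 1 / 2 := by
      change A * _ = _
      field_simp
    rw [this]
    exact NNReal.half_lt_self one_ne_zero
  have hη' : ∀ t ∈ Icc (0 : ℝ) 1, η t = γ t + F (γ t) := by
    intro t ht
    rw [← hEq (mem_image_of_mem γ ht), hf t ht, add_sub_cancel]
  constructor
  · intro s hs' t ht hst
    obtain ⟨h, hh⟩ := exists_homeomorph_add hF hK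
    rw [hη' s hs', hη' t ht, ← hh, ← hh] at hst
    exact hs s hs' t ht (h.injective hst)
  · have := ambientIsotopic_image_add hF hK (γ '' Icc 0 1)
    rw [image_image] at this
    rwa [image_congr hη']

/-! ### Composite curves under repeated subdivision -/

namespace CompositeBezier

theorem exists_mem_knot_Icc (C : CompositeBezier) {t : ℝ} (ht : t ∈ Icc (0 : ℝ) 1) :
    ∃ k < C.m, t ∈ Icc (C.knot k) (C.knot (k + 1)) := by
  have h : ∀ j, 0 < j → t ≤ C.knot j → ∃ k < j, t ∈ Icc (C.knot k) (C.knot (k + 1)) := by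
    intro j
    induction j with
    | zero => exact fun h => absurd h (lt_irrefl 0)
    | succ j ih =>
      intro _ hj
      rcases le_total (C.knot j) t with h1 | h1
      · exact ⟨j, j.lt_succ_self, h1, hj⟩
      · rcases Nat.eq_zero_or_pos j with rfl | hj0
        · exact ⟨0, one_pos, by rw [C.knot_zero]; exact ht.1, hj⟩
        · obtain ⟨k, hk, hk'⟩ := ih hj0 h1
          exact ⟨k, by omega, hk'⟩
  exact h C.m C.m_pos (by rw [C.knot_last]; exact ht.2)

theorem subdivide_curve (C : CompositeBezier) {t : ℝ} (ht : t ∈ Icc (0 : ℝ) 1) :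
    C.subdivide.curve t = C.curve t := by
  obtain ⟨k, hk, hkt⟩ := C.exists_mem_knot_Icc ht
  have hlt := C.knot_lt k hk
  have hne : C.knot (k + 1) - C.knot k ≠ 0 := by linarith
  have e0 : 2 * k % 2 = 0 := by omega
  have e1 : (2 * k + 1) % 2 = 1 := by omega
  have e2 : (2 * k + 1 + 1) % 2 = 0 := by omega
  have d0 : 2 * k / 2 = k := by omega
  have d1 : (2 * k + 1) / 2 = k := by omega
  have d2 : (2 * k + 1 + 1) / 2 = k + 1 := by omega
  have k0 : C.subdivide.knot (2 * k) = C.knot k := by simp only [subdivide, e0, d0, if_true]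
  have k1 : C.subdivide.knot (2 * k + 1) = (C.knot k + C.knot (k + 1)) / 2 := by
    simp only [subdivide, e1, d1, one_ne_zero, if_false]
  have k2 : C.subdivide.knot (2 * k + 1 + 1) = C.knot (k + 1) := by
    simp only [subdivide, e2, d2, if_true]
  rw [C.curve_eq hk hkt]
  rcases le_total t ((C.knot k + C.knot (k + 1)) / 2) with h | h
  · rw [C.subdivide.curve_eq (k := 2 * k) (Nat.mul_lt_mul_of_pos_left hk two_pos)
      ⟨by rw [k0]; exact hkt.1, by rw [k1]; exact h⟩]
    have hd : C.subdivide.deg (2 * k) = C.deg k := by simp only [subdivide, d0]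
    have hp : C.subdivide.ctrl (2 * k) = leftHalf (C.ctrl k) := by
      simp only [subdivide, e0, d0, if_true]
    rw [hd, hp, bezier_leftHalf, localParam, localParam, k0, k1]
    rw [show (C.knot k + C.knot (k + 1)) / 2 - C.knot k = (C.knot (k + 1) - C.knot k) / 2 by ring]
    congr 1
    field_simp
  · rw [C.subdivide.curve_eq (k := 2 * k + 1) (by simp only [subdivide]; omega)
      ⟨by rw [k1]; exact h, by rw [k2]; exact hkt.2⟩]
    have hd : C.subdivide.deg (2 * k + 1) = C.deg k := by simp only [subdivide, d1]
    have hp : C.subdivide.ctrl (2 * k + 1) = rightHalf (C.deg k) (C.ctrl k) := by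
      simp only [subdivide, e1, d1, one_ne_zero, if_false]
    rw [hd, hp, bezier_rightHalf, localParam, localParam, k1, k2]
    rw [show C.knot (k + 1) - (C.knot k + C.knot (k + 1)) / 2 = (C.knot (k + 1) - C.knot k) / 2 by
      ring]
    congr 1
    field_simp
    ring

theorem subdivide_iterate_curve (C : CompositeBezier) (i : ℕ) {t : ℝ} (ht : t ∈ Icc (0 : ℝ) 1) :
    (subdivide^[i] C).curve t = C.curve t := by
  induction i with
  | zero => rfl
  | succ i ih => rw [Function.iterate_succ_apply', subdivide_curve _ ht, ih]

/-- The degrees of the segments are at most `d`, the knot intervals have length at least `h`, and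
the second differences of the control points have norm at most `M`. -/
def HasBounds (C : CompositeBezier) (d : ℕ) (h M : ℝ) : Prop :=
  ∀ k < C.m, C.deg k ≤ d ∧ h ≤ C.knot (k + 1) - C.knot k ∧
    ∀ l, l + 2 ≤ C.deg k → ‖secondDiff (C.ctrl k) l‖ ≤ M

theorem exists_hasBounds (C : CompositeBezier) :
    ∃ (d : ℕ) (h M : ℝ), 0 < h ∧ 0 ≤ M ∧ C.HasBounds d h M := by
  obtain ⟨k₀, hk₀, hmin⟩ := Finset.exists_min_image (Finset.range C.m)
    (fun k => C.knot (k + 1) - C.knot k) ⟨0, Finset.mem_range.2 C.m_pos⟩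
  refine ⟨∑ k ∈ Finset.range C.m, C.deg k, C.knot (k₀ + 1) - C.knot k₀,
    ∑ k ∈ Finset.range C.m, ∑ l ∈ Finset.range (C.deg k), ‖secondDiff (C.ctrl k) l‖,
    sub_pos.2 (C.knot_lt k₀ (Finset.mem_range.1 hk₀)),
    Finset.sum_nonneg fun _ _ => Finset.sum_nonneg fun _ _ => norm_nonneg _, fun k hk => ?_⟩
  have hk' := Finset.mem_range.2 hk
  refine ⟨Finset.single_le_sum (fun _ _ => Nat.zero_le _) hk', hmin k hk', fun l hl => ?_⟩
  exact (Finset.single_le_sum (f := fun l => ‖secondDiff (C.ctrl k) l‖)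
    (fun _ _ => norm_nonneg _) (Finset.mem_range.2 (by omega))).trans
    (Finset.single_le_sum
      (f := fun k => ∑ l ∈ Finset.range (C.deg k), ‖secondDiff (C.ctrl k) l‖)
      (fun _ _ => Finset.sum_nonneg fun _ _ => norm_nonneg _) hk')

theorem HasBounds.subdivide {C : CompositeBezier} {d : ℕ} {h M : ℝ} (hC : C.HasBounds d h M) :
    C.subdivide.HasBounds d (h / 2) (M / 4) := by
  intro k hk
  have hk : k < 2 * C.m := hk
  obtain ⟨h1, h2, h3⟩ := hC (k / 2) (by omega)
  refine ⟨h1, ?_⟩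
  rcases Nat.mod_two_eq_zero_or_one k with e | e
  · have e1 : (k + 1) % 2 = 1 := by omega
    have e2 : (k + 1) / 2 = k / 2 := by omega
    simp only [CompositeBezier.subdivide, e, e1, e2, if_true, one_ne_zero, if_false]
    exact ⟨by linarith, fun l hl => norm_secondDiff_leftHalf_le h3 hl⟩
  · have e1 : (k + 1) % 2 = 0 := by omega
    have e2 : (k + 1) / 2 = k / 2 + 1 := by omega
    simp only [CompositeBezier.subdivide, e, e1, e2, if_true, one_ne_zero, if_false]
    exact ⟨by linarith, fun l hl => norm_secondDiff_rightHalf_le h3 hl⟩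

theorem HasBounds.subdivide_iterate {C : CompositeBezier} {d : ℕ} {h M : ℝ}
    (hC : C.HasBounds d h M) (i : ℕ) :
    (CompositeBezier.subdivide^[i] C).HasBounds d (h / 2 ^ i) (M / 4 ^ i) := by
  induction i with
  | zero => simpa using hC
  | succ i ih =>
    rw [Function.iterate_succ_apply', pow_succ, pow_succ, ← div_div, ← div_div]
    exact ih.subdivide

/-- Passing from the local parameter of a segment to the global one costs a factor of at most `1 /
h`. -/
theorem HasBounds.norm_polygon_sub_curve_le {C : CompositeBezier} {d : ℕ} {h M : ℝ}
    (hC : C.HasBounds d h M) (hh : 0 < h) (hM : 0 ≤ M) {s t : ℝ} (hs : 0 ≤ s) (hst : s ≤ t)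
    (ht : t ≤ 1) :
    ‖(C.polygon t - C.curve t) - (C.polygon s - C.curve s)‖
      ≤ 2 * (d : ℝ) ^ 2 * M / h * (t - s) := by
  refine norm_sub_le_of_piecewise (f := fun t => C.polygon t - C.curve t) (a := C.knot) (m := C.m)
    ?_ (by rwa [C.knot_zero]) hst (by rwa [C.knot_last])
  intro k hk s t hs hst ht
  obtain ⟨h1, h2, h3⟩ := hC k hk
  have hpos : 0 < C.knot (k + 1) - C.knot k := hh.trans_le h2
  rw [C.polygon_eq hk ⟨hs, hst.trans ht⟩, C.polygon_eq hk ⟨hs.trans hst, ht⟩,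
    C.curve_eq hk ⟨hs, hst.trans ht⟩, C.curve_eq hk ⟨hs.trans hst, ht⟩]
  have hst' : C.localParam k s ≤ C.localParam k t :=
    div_le_div_of_nonneg_right (by linarith) hpos.le
  have e : C.localParam k t - C.localParam k s = (t - s) / (C.knot (k + 1) - C.knot k) := by
    rw [localParam, localParam, ← sub_div]
    ring
  have hts : 0 ≤ t - s := sub_nonneg.2 hst
  calc _ ≤ 2 * (C.deg k : ℝ) ^ 2 * M * (C.localParam k t - C.localParam k s) :=
        norm_polyPath_sub_bezier_le hM h3 (div_nonneg (by linarith) hpos.le) hst'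
          ((div_le_one hpos).2 (by linarith))
    _ ≤ 2 * (d : ℝ) ^ 2 * M * ((t - s) / h) := by
        rw [e]
        gcongr
    _ = _ := by ring

theorem polygon_zero (C : CompositeBezier) : C.polygon 0 = C.curve 0 := by
  have h : (0 : ℝ) ∈ Icc (C.knot 0) (C.knot (0 + 1)) :=
    ⟨C.knot_zero.le, C.knot_zero ▸ (C.knot_lt 0 C.m_pos).le⟩
  have e : C.localParam 0 0 = 0 := by simpa only [C.knot_zero] using C.localParam_left 0
  rw [C.polygon_eq C.m_pos h, C.curve_eq C.m_pos h, e, polyPath_zero, bezier_zero]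

theorem polygon_one (C : CompositeBezier) : C.polygon 1 = C.curve 1 := by
  have hm : C.m - 1 < C.m := Nat.sub_lt C.m_pos one_pos
  have hk : C.knot (C.m - 1 + 1) = 1 := by rw [Nat.sub_add_cancel C.m_pos, C.knot_last]
  have h : (1 : ℝ) ∈ Icc (C.knot (C.m - 1)) (C.knot (C.m - 1 + 1)) :=
    ⟨hk ▸ (C.knot_lt _ hm).le, hk.ge⟩
  have e : C.localParam (C.m - 1) 1 = 1 := by simpa only [hk] using C.localParam_right hm
  rw [C.polygon_eq hm h, C.curve_eq hm h, e, polyPath_one, bezier_one]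

end CompositeBezier

theorem mainTheorem3 (C : CompositeBezier)
    (hsimple : IsSimpleCurve C.curve)
    (hregular : IsRegularCurve C.curve)
    (hC1 : IsC1Curve C.curve) :
    ∃ N : ℕ, ∀ i : ℕ, N ≤ i →
      IsSimpleCurve (CompositeBezier.subdivide^[i] C).polygon ∧
        AmbientIsotopic ((CompositeBezier.subdivide^[i] C).polygon '' Set.Icc (0 : ℝ) 1)
          (C.curve '' Set.Icc (0 : ℝ) 1) := by
  obtain ⟨ε, hε, H⟩ := exists_isSimpleCurve_and_ambientIsotopic hsimple hregular hC1
  obtain ⟨d, h, M, hh, hM, hC⟩ := C.exists_hasBounds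
  -- The ratio `(M / 4 ^ i) / (h / 2 ^ i)` leaves the factor `(1 / 2) ^ i`.
  have hlim : Filter.Tendsto (fun i : ℕ => 2 * (d : ℝ) ^ 2 * M / h * (1 / 2) ^ i) Filter.atTop
      (nhds (2 * (d : ℝ) ^ 2 * M / h * 0)) :=
    (tendsto_pow_atTop_nhds_zero_of_lt_one (by norm_num) (by norm_num)).const_mul _
  rw [mul_zero] at hlim
  obtain ⟨N, hN⟩ := Filter.eventually_atTop.1 (hlim.eventually_le_const hε)
  refine ⟨N, fun i hi => H _ ?_ ?_ ?_⟩
  · rw [CompositeBezier.polygon_zero, C.subdivide_iterate_curve i ⟨le_rfl, zero_le_one⟩]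
  · rw [CompositeBezier.polygon_one, C.subdivide_iterate_curve i ⟨zero_le_one, le_rfl⟩]
  · intro s t hs hst ht
    rw [← C.subdivide_iterate_curve i ⟨hs, hst.trans ht⟩,
      ← C.subdivide_iterate_curve i ⟨hs.trans hst, ht⟩]
    refine ((hC.subdivide_iterate i).norm_polygon_sub_curve_le (by positivity) (by positivity)
      hs hst ht).trans (mul_le_mul_of_nonneg_right (le_trans (le_of_eq ?_) (hN i hi))
        (sub_nonneg.2 hst))
    rw [show (4 : ℝ) ^ i = 2 ^ i * 2 ^ i by rw [← mul_pow]; norm_num, one_div, inv_pow]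
    field_simp
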